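/- Let $\mathbb F_q\subseteq\mathbb F_{q^m}$ be finite fields of characteristic $2$, and let $x\in\mathbb F_{q^m}^n$ have pairwise distinct entries. For $y\in(\mathbb F_{q^m}^{*})^n$ put $\mathrm{GRS}_r(x,y)=\{(y_iP(x_i))_{1\le i\le n} : P\in\mathbb F_{q^m}[z],\ \deg P<r\}$; the alternant code of degree $r$ and extension degree $m$ is $\mathcal A_r(x,y)=\mathrm{GRS}_r(x,y)^{\perp}\cap\mathbb F_q^n$. For $\Gamma\in\mathbb F_{q^m}[z]$ of degree $r$ with $\Gamma(x_i)\neq0$ for all $i$, the Goppa code is $\mathcal G(x,\Gamma)=\mathcal A_r\big(x,(1/\Gamma(x_i))_i\big)$; it is binary if $q=2$. For a code $\mathcal C\subseteq\mathbb F_q^n$ let $\mathcal D$ be the $\mathbb F_{q^m}$-linear span of $\mathcal C^\perp$ in $\mathbb F_{q^m}^n$ (the extended dual), and let $v_1,\dots,v_s$ be any basis of $\mathcal D$. With $\star$ the componentwise product, the matrix code of quadratic relations $\mathcal C_{\mathrm{mat}}$ is the space of all symmetric $s\times s$ matrices $M_c$ over $\mathbb F_{q^m}$ with entries $(M_c)_{i,j}=(M_c)_{j,i}=c_{i,j}$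 for $i<j$ and $(M_c)_{i,i}=2c_{i,i}=0$, where $c=(c_{i,j})_{1\le i\le j\le s}$ runs through the solutions of $\sum_{i\le j}c_{i,j}\,v_i\star v_j=0$. In the polynomial ring $\mathbb F_{q^m}[m_{i,j}:1\le i<j\le s]$ let $$\mathcal P_2^+(M)=\big\langle m_{i,j}m_{k,l}+m_{i,k}m_{j,l}+m_{i,l}m_{j,k} : 1\le i<j<k<l\le s\big\rangle+\langle L\rangle,$$ where $L$ runs through the linear forms $\sum_{i<j}a_{i,j}m_{i,j}$, $a_{i,j}\in\mathbb F_{q^m}$, that vanish on $\mathcal C_{\mathrm{mat}}$. Let $\mathbf V(\mathcal P_2^+(M))$ be its zero set over the algebraic closure $\overline{\mathbb F_{q^m}}$, and let $\dim$ denote the dimension of an affine algebraic set (the Krull dimension of its coordinate ring). Then: 1. If $\mathcal C=\mathcal A_r(x,y)$ is an alternant code with $\dim_{\mathbb F_q}\mathcal C=n-rm$, then $\dim\mathbf V(\mathcal P_2^+(M))\ge r-2$. 2. If $q=2$ and $\mathcal C=\mathcal G(x,\Gamma)$ is a binary Goppa code with $\Gamma$ square-free of degree $r$ and $\dim_{\mathbb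 F_2}\mathcal C=n-rm$, then $\dim\mathbf V(\mathcal P_2^+(M))\ge 2r-3$. -/

import Mathlib

open scoped Polynomial

noncomputable section

namespace CodeRelations

section Codes

/-- The generalized Reed-Solomon code with support `x` and multiplier `y`:
all vectors `(y₁ P(x₁), …, yₙ P(xₙ))` with `deg P < r`. -/
def grs {F : Type*} [Field F] {n : ℕ} (r : ℕ) (x y : Fin n → F) : Submodule F (Fin n → F) :=
  (Polynomial.degreeLT F r).map
    (LinearMap.pi (fun i => y i • Polynomial.leval (x i)) : F[X] →ₗ[F] (Fin n → F))

/-- The dual code with respect to the standard scalar product. -/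
def dualCode {F : Type*} [Field F] {n : ℕ} (C : Submodule F (Fin n → F)) :
    Submodule F (Fin n → F) where
  carrier := {d | ∀ c ∈ C, ∑ i, c i * d i = 0}
  zero_mem' := by
    intro c _
    simp
  add_mem' := by
    intro a b ha hb c hc
    simp [mul_add, Finset.sum_add_distrib, ha c hc, hb c hc]
  smul_mem' := by
    intro t a ha c hc
    have h : ∑ i, c i * (t • a) i = t * ∑ i, c i * a i := by
      rw [Finset.mul_sum]
      refine Finset.sum_congr rfl fun i _ => ?_
      simp only [Pi.smul_apply, smul_eq_mul]
      ring
    rw [h, ha c hc, mul_zero]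

/-- The alternant code over `K` of degree `r`: the vectors with entries in the subfield `K` that
lie in the dual of the GRS code over `L`. -/
def alternant (K : Type*) {L : Type*} [Field K] [Field L] [Algebra K L] {n : ℕ} (r : ℕ)
    (x y : Fin n → L) : Submodule K (Fin n → K) :=
  ((dualCode (grs r x y)).restrictScalars K).comap ((Algebra.linearMap K L).compLeft (Fin n))

/-- The Goppa code over `K` with support `x` and Goppa polynomial `Γ`: the alternant code of
degree `deg Γ` with multiplier `1 / Γ(x)`. -/
def goppa (K : Type*) {L : Type*} [Field K] [Field L] [Algebra K L] {n : ℕ}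
    (x : Fin n → L) (Γ : L[X]) : Submodule K (Fin n → K) :=
  alternant K Γ.natDegree x (fun i => (Γ.eval (x i))⁻¹)

/-- The extension of a code over `K` to the field `L`: its `L`-linear span in `Lⁿ`. -/
def extendCode {K : Type*} (L : Type*) [Field K] [Field L] [Algebra K L] {n : ℕ}
    (C : Submodule K (Fin n → K)) : Submodule L (Fin n → L) :=
  Submodule.span L ((fun c : Fin n → K => fun i => algebraMap K L (c i)) '' (C : Set (Fin n → K)))

end Codes

section Relations

variable {F : Type*} [Field F] {n s : ℕ}

/-- The code of relations between the Schur (componentwise) products of the vectors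
`v₁, …, vₛ`: the families `(c_{i,j})_{i ≤ j}` with `∑_{i ≤ j} c_{i,j} vᵢ ⋆ vⱼ = 0`. -/
def relCode (v : Fin s → Fin n → F) :
    Submodule F ({p : Fin s × Fin s // p.1 ≤ p.2} → F) where
  carrier := {c | ∑ p, c p • (v p.1.1 * v p.1.2) = 0}
  zero_mem' := by simp
  add_mem' := by
    intro a b ha hb
    simp only [Set.mem_ofPred_eq] at ha hb ⊢
    simp [add_smul, Finset.sum_add_distrib, ha, hb]
  smul_mem' := by
    intro t a ha
    simp only [Set.mem_ofPred_eq] at ha ⊢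
    simp [mul_smul, ← Finset.smul_sum, ha]

/-- The symmetric matrix of the polar form of the quadratic form `∑_{i ≤ j} c_{i,j} xᵢ xⱼ`:
off-diagonal entries `c_{i,j}`, diagonal entries `2 c_{i,i}`. -/
def polarMatrix : ({p : Fin s × Fin s // p.1 ≤ p.2} → F) →ₗ[F] Matrix (Fin s) (Fin s) F where
  toFun c := Matrix.of fun i j =>
    if h : i < j then c ⟨(i, j), h.le⟩
    else if h' : j < i then c ⟨(j, i), h'.le⟩
    else 2 * c ⟨(i, i), le_rfl⟩
  map_add' a b := by
    ext i j
    simp only [Matrix.of_apply, Matrix.add_apply, Pi.add_apply]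
    split_ifs <;> ring
  map_smul' t a := by
    ext i j
    simp only [Matrix.of_apply, Matrix.smul_apply, Pi.smul_apply, smul_eq_mul, RingHom.id_apply]
    split_ifs <;> ring

/-- The matrix code of quadratic relations between the vectors `v₁, …, vₛ`. -/
def matCode (v : Fin s → Fin n → F) : Submodule F (Matrix (Fin s) (Fin s) F) :=
  (relCode v).map polarMatrix

end Relations

section Pfaffian

/-- The indices of the independent entries `m_{i,j}`, `i < j`, of a skew-symmetric matrix. -/
abbrev SkewIndex (s : ℕ) : Type := {p : Fin s × Fin s // p.1 < p.2}

/-- The generic skew-symmetric matrix in characteristic 2: zero diagonal, and `m_{j,i}` with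
`i < j` is an alias of the variable `m_{i,j}`. -/
def genericSkew (F : Type*) [Field F] (s : ℕ) :
    Matrix (Fin s) (Fin s) (MvPolynomial (SkewIndex s) F) :=
  Matrix.of fun i j =>
    if h : i < j then MvPolynomial.X ⟨(i, j), h⟩
    else if h' : j < i then MvPolynomial.X ⟨(j, i), h'⟩
    else 0

/-- The Pfaffian ideal of rank 2 of the generic `s × s` skew-symmetric matrix in
characteristic 2. -/
def pfaffianIdeal (F : Type*) [Field F] (s : ℕ) : Ideal (MvPolynomial (SkewIndex s) F) :=
  Ideal.span {f | ∃ i j k l : Fin s, i < j ∧ j < k ∧ k < l ∧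
    f = genericSkew F s i j * genericSkew F s k l + genericSkew F s i k * genericSkew F s j l
      + genericSkew F s i l * genericSkew F s j k}

/-- The ideal generated by the linear forms `∑_{i < j} a_{i,j} m_{i,j}` that vanish on every
matrix of `D`. -/
def linearIdeal {F : Type*} [Field F] {s : ℕ} (D : Submodule F (Matrix (Fin s) (Fin s) F)) :
    Ideal (MvPolynomial (SkewIndex s) F) :=
  Ideal.span {f | ∃ a : SkewIndex s → F,
    (∀ M ∈ D, ∑ p, a p * M p.1.1 p.1.2 = 0) ∧
    f = ∑ p, MvPolynomial.C (a p) * genericSkew F s p.1.1 p.1.2}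

/-- The ideal `𝒫₂⁺(M)` attached to a matrix code `D` of skew-symmetric matrices: the Pfaffian
ideal together with the linear equations of `D`. -/
def pfaffianIdealPlus {F : Type*} [Field F] {s : ℕ}
    (D : Submodule F (Matrix (Fin s) (Fin s) F)) : Ideal (MvPolynomial (SkewIndex s) F) :=
  pfaffianIdeal F s ⊔ linearIdeal D

end Pfaffian

/-- The variety of an ideal of `F[z]`, as a set of points over the algebraic closure of `F`. -/
def variety {F : Type*} [Field F] {σ : Type*} (I : Ideal (MvPolynomial σ F)) :
    Set (σ → AlgebraicClosure F) :=
  MvPolynomial.zeroLocus (AlgebraicClosure F) I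

/-- The dimension of an algebraic subset `V` of affine space over the field `k`: the Krull
dimension of its coordinate ring `k[z] / I(V)`. -/
def affineDim {k : Type*} [Field k] {σ : Type*} (V : Set (σ → k)) : WithBot ℕ∞ :=
  ringKrullDim (MvPolynomial σ k ⧸ MvPolynomial.vanishingIdeal k V)

end CodeRelations

end

open CodeRelations

/-!
Every linear form that vanishes on the matrix code is `m ↦ ∑_{i<j} β(vᵢ ⋆ vⱼ) mᵢⱼ` for a functional
`β` on `Fⁿ` with `β(vᵢ ⋆ vᵢ) = 0` for all `i`. In characteristic 2 its value at a rank 2 matrix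
`f ∧ g` is therefore `β(f ⋆ g)`. If `f ⋆ g = h ⋆ h` for some `h` in the span of the `vᵢ`, this
equals the value at `h ∧ h = 0`, so `f ∧ g` is a point of the variety.

If the code spanned by the `vᵢ` contains `y, y ⋆ x, …, y ⋆ x^(r-1)`, such points are obtained from
the combinations `f` of the first `r - 2` of these vectors with `g = x² ⋆ f` and `h = x ⋆ f`, and
they form a family of dimension `r - 2`. The extended dual of an alternant code contains these
vectors. For a binary Goppa code with square-free `Γ`, every polynomial is a square modulo `Γ`
because the field is perfect, hence `Γ` and `Γ²` define the same code and `r` can be replaced by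
`2r`, as long as `2r ≤ n`. If `2r ≥ n`, the extended dual is the whole space; since every vector
over an algebraically closed field is a square, all `f ∧ g` are points of the variety, and they form
the cone over a Grassmannian, of dimension `2n - 3`.

The dimension of a parametrized family is bounded below by restricting the parameters to a flag of
coordinate subspaces: the kernels of the pullbacks are a chain of primes, and it is strict if at
each step some coordinate of the family becomes nonzero.
-/

namespace CodeRelations

section Dimension

theorem natCast_le_ringKrullDim_of_ker_lt {A B : Type*} [CommRing A] [CommRing B] [IsDomain B]
    {d : ℕ} (φ : ℕ → A →+* B) (hφ : ∀ j < d, RingHom.ker (φ (j + 1)) < RingHom.ker (φ j)) :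
    (d : WithBot ℕ∞) ≤ ringKrullDim A :=
  Order.LTSeries.length_le_krullDim
    { length := d
      toFun := fun i => ⟨RingHom.ker (φ (d - i)), RingHom.ker_isPrime _⟩
      step := fun i => by
        have hi : d - (i.castSucc : ℕ) = d - (i.succ : ℕ) + 1 := by
          rw [Fin.val_castSucc, Fin.val_succ]; omega
        rw [hi]
        exact hφ _ (by rw [Fin.val_succ]; omega) }

variable {k : Type*} [Field k] {d : ℕ}

/-- Restriction of polynomial functions on affine `d`-space to the coordinate subspace on which all
variables with index at least `j` vanish. These subspaces form the flag whose images bound the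
dimension of a parametrized variety from below. -/
noncomputable def restrictVars (k : Type*) [Field k] {d : ℕ} (j : ℕ) :
    MvPolynomial (Fin d) k →ₐ[k] MvPolynomial (Fin d) k :=
  MvPolynomial.aeval fun i => if (i : ℕ) < j then MvPolynomial.X i else 0

theorem restrictVars_X (j : ℕ) (i : Fin d) :
    restrictVars k j (MvPolynomial.X i) = if (i : ℕ) < j then MvPolynomial.X i else 0 :=
  MvPolynomial.aeval_X _ _

theorem restrictVars_restrictVars {i j : ℕ} (hij : i ≤ j) (p : MvPolynomial (Fin d) k) :
    restrictVars k i (restrictVars k j p) = restrictVars k i p := by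
  rw [← AlgHom.comp_apply]
  congr 1
  ext a : 1
  rw [AlgHom.comp_apply, restrictVars_X, restrictVars_X]
  split_ifs <;> first | omega | simp_all [restrictVars_X]

theorem natCast_le_affineDim_of_param [Infinite k] {σ : Type*} {V : Set (σ → k)}
    (P : σ → MvPolynomial (Fin d) k) (hV : ∀ u, (fun i => MvPolynomial.eval u (P i)) ∈ V)
    (hP : ∀ j : Fin d, ∃ q : MvPolynomial σ k,
      restrictVars k j (MvPolynomial.aeval P q) = 0 ∧
      restrictVars k (j + 1) (MvPolynomial.aeval P q) ≠ 0) :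
    (d : WithBot ℕ∞) ≤ affineDim V := by
  have pullback_eq_zero : ∀ p ∈ MvPolynomial.vanishingIdeal k V, MvPolynomial.aeval P p = 0 := by
    intro p hp
    refine MvPolynomial.funext fun u => ?_
    rw [map_zero, ← hp _ (hV u), ← MvPolynomial.aeval_eq_eval, ← AlgHom.comp_apply,
      MvPolynomial.comp_aeval]
  let pullback := Ideal.Quotient.liftₐ (MvPolynomial.vanishingIdeal k V) (MvPolynomial.aeval P)
    pullback_eq_zero
  refine natCast_le_ringKrullDim_of_ker_lt
    (fun j => ((restrictVars k j).comp pullback : _ →+* MvPolynomial (Fin d) k)) fun j hj => ?_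
  refine lt_of_le_not_ge (fun p hp => ?_) fun hle => ?_
  · have h : restrictVars k (j + 1) (pullback p) = 0 := hp
    change restrictVars k j (pullback p) = 0
    rw [← restrictVars_restrictVars j.le_succ, h, map_zero]
  · obtain ⟨q, hq, hq'⟩ := hP ⟨j, hj⟩
    exact hq' (hle (x := Ideal.Quotient.mk _ q) hq)

end Dimension

section Wedge

variable {ι κ R : Type*} [CommRing R]

/-- The matrix `p qᵀ + q pᵀ`. In characteristic 2 it is the skew-symmetric matrix `p ∧ q`; its
entries above the diagonal are the Plücker coordinates of the span of `p` and `q`. -/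
def wedge (p q : ι → R) : Matrix ι ι R :=
  Matrix.vecMulVec p q + Matrix.vecMulVec q p

theorem wedge_apply (p q : ι → R) (i j : ι) : wedge p q i j = p i * q j + q i * p j :=
  rfl

theorem wedge_vecMul_vecMul [Fintype ι] (p q : ι → R) (T : Matrix ι κ R) :
    wedge (Matrix.vecMul p T) (Matrix.vecMul q T) = T.transpose * wedge p q * T := by
  simp only [wedge, Matrix.mul_add, Matrix.add_mul, Matrix.mul_vecMulVec, Matrix.vecMulVec_mul,
    Matrix.mulVec_transpose]

theorem map_wedge {S : Type*} [CommRing S] (f : R →+* S) (p q : ι → R) :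
    (wedge p q).map f = wedge (f ∘ p) (f ∘ q) := by
  ext i j
  simp [wedge_apply]

variable {F : Type*} [Field F] [Algebra F R] {s : ℕ}

theorem aeval_genericSkew [CharP R 2] (p q : Fin s → R) (i j : Fin s) :
    MvPolynomial.aeval (fun a : SkewIndex s => wedge p q a.1.1 a.1.2) (genericSkew F s i j) =
      wedge p q i j := by
  simp only [genericSkew, Matrix.of_apply]
  split_ifs with hij hji
  · exact MvPolynomial.aeval_X _ _
  · rw [MvPolynomial.aeval_X, wedge_apply, wedge_apply]
    ring
  · obtain rfl : i = j := le_antisymm (not_lt.1 hji) (not_lt.1 hij)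
    rw [map_zero, wedge_apply, mul_comm (q i), CharTwo.add_self_eq_zero]

theorem aeval_transpose_mul_genericSkew_mul [CharP R 2] (p q : Fin s → R)
    (S : Matrix (Fin s) ι F) (a b : ι) :
    MvPolynomial.aeval (fun a : SkewIndex s => wedge p q a.1.1 a.1.2)
        (((S.map (algebraMap F (MvPolynomial (SkewIndex s) F))).transpose * genericSkew F s *
          S.map (algebraMap F (MvPolynomial (SkewIndex s) F))) a b) =
      wedge (Matrix.vecMul p (S.map (algebraMap F R)))
        (Matrix.vecMul q (S.map (algebraMap F R))) a b := by
  rw [wedge_vecMul_vecMul]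
  simp only [Matrix.mul_apply, Matrix.transpose_apply, Matrix.map_apply, map_sum, map_mul,
    AlgHom.commutes, aeval_genericSkew]

end Wedge

section SkewSum

variable {R : Type*} {s n : ℕ}

theorem sum_sum_eq_sum_skewIndex [AddCommMonoid R] {a : Fin s → Fin s → R} (ha : ∀ i, a i i = 0) :
    ∑ i, ∑ j, a i j = ∑ p : SkewIndex s, (a p.1.1 p.1.2 + a p.1.2 p.1.1) := by
  calc ∑ i, ∑ j, a i j
      = ∑ i, ∑ j, ((if i < j then a i j else 0) + if j < i then a i j else 0) := by
        refine Finset.sum_congr rfl fun i _ => Finset.sum_congr rfl fun j _ => ?_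
        rcases lt_trichotomy i j with h | rfl | h <;> simp [*, lt_asymm]
    _ = ∑ i, ∑ j, if i < j then a i j + a j i else 0 := by
        simp only [Finset.sum_add_distrib]
        rw [Finset.sum_comm (f := fun i j => if j < i then a i j else 0)]
        simp only [← Finset.sum_add_distrib, ← ite_add_zero]
    _ = ∑ p : SkewIndex s, (a p.1.1 p.1.2 + a p.1.2 p.1.1) := by
        rw [← Fintype.sum_prod_type' (f := fun i j => if i < j then a i j + a j i else 0),
          ← Finset.sum_filter]
        exact Finset.sum_subtype _ (by simp) _

theorem sum_skewIndex_mul_wedge [CommRing R] (V : Fin s → Fin n → R) (b : Fin n → R)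
    (hb : ∀ i, ∑ t, b t * (V i t * V i t) = 0) (f g : Fin s → R) :
    ∑ p : SkewIndex s, (∑ t, b t * (V p.1.1 t * V p.1.2 t)) * wedge f g p.1.1 p.1.2 =
      ∑ t, b t * ((∑ i, f i • V i) * ∑ j, g j • V j) t := by
  have hdiag : ∀ i, (∑ t, b t * (V i t * V i t)) * (f i * g i) = 0 := fun i => by
    rw [hb, zero_mul]
  calc ∑ p : SkewIndex s, (∑ t, b t * (V p.1.1 t * V p.1.2 t)) * wedge f g p.1.1 p.1.2
      = ∑ i, ∑ j, (∑ t, b t * (V i t * V j t)) * (f i * g j) := by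
        rw [sum_sum_eq_sum_skewIndex hdiag]
        refine Finset.sum_congr rfl fun p _ => ?_
        simp only [wedge_apply, mul_comm (V p.1.2 _)]
        ring
    _ = ∑ t, ∑ i, ∑ j, b t * ((f i * V i t) * (g j * V j t)) := by
        simp only [Finset.sum_mul]
        rw [Finset.sum_comm_cycle]
        refine Finset.sum_congr rfl fun t _ => Finset.sum_congr rfl fun i _ =>
          Finset.sum_congr rfl fun j _ => ?_
        ring
    _ = ∑ t, b t * ((∑ i, f i • V i) * ∑ j, g j • V j) t := by
        simp only [← Finset.mul_sum, ← Finset.sum_mul, Pi.mul_apply, Finset.sum_apply,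
          Pi.smul_apply, smul_eq_mul]

end SkewSum

section Points

variable {F k : Type*} [Field F] [Field k] [Algebra F k] {s n : ℕ}

theorem exists_eq_sum_of_forall_matCode {v : Fin s → Fin n → F} {a : SkewIndex s → F}
    (ha : ∀ M ∈ matCode v, ∑ p : SkewIndex s, a p * M p.1.1 p.1.2 = 0) :
    ∃ b : Fin n → F, (∀ i, ∑ t, b t * (v i t * v i t) = 0) ∧
      ∀ p : SkewIndex s, a p = ∑ t, b t * (v p.1.1 t * v p.1.2 t) := by
  let evalProducts := Fintype.linearCombination F
    fun q : {p : Fin s × Fin s // p.1 ≤ p.2} => v q.1.1 * v q.1.2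
  let form : Module.Dual F ({p : Fin s × Fin s // p.1 ≤ p.2} → F) :=
    ∑ p : SkewIndex s, a p • LinearMap.proj ⟨p.1, p.2.le⟩
  have form_apply : ∀ c, form c = ∑ p : SkewIndex s, a p * c ⟨p.1, p.2.le⟩ := fun c => by
    simp [form]
  -- The forms vanishing on the kernel of a linear map are those that factor through the map.
  have form_mem : form ∈ evalProducts.dualMap.range := by
    rw [LinearMap.range_dualMap_eq_dualAnnihilator_ker, Submodule.mem_dualAnnihilator]
    intro c hc
    rw [form_apply, ← ha _ (Submodule.mem_map_of_mem hc)]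
    refine Finset.sum_congr rfl fun p _ => ?_
    simp [polarMatrix, p.2]
  obtain ⟨β, hβ⟩ := form_mem
  obtain ⟨b, rfl⟩ := (dotProductEquiv F (Fin n)).surjective β
  have sum_eq : ∀ q : {p : Fin s × Fin s // p.1 ≤ p.2},
      ∑ t, b t * (v q.1.1 t * v q.1.2 t) = form (Pi.single q 1) := fun q => by
    simp [← hβ, evalProducts, dotProduct]
  refine ⟨b, fun i => ?_, fun p => ?_⟩
  · rw [sum_eq ⟨(i, i), le_rfl⟩, form_apply]
    refine Finset.sum_eq_zero fun p _ => ?_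
    rw [Pi.single_eq_of_ne, mul_zero]
    intro h
    exact p.2.ne (by rw [Subtype.mk.inj h])
  · rw [sum_eq ⟨p.1, p.2.le⟩, form_apply]
    simp [Pi.single_apply, ← Subtype.ext_iff]

theorem wedge_mem_zeroLocus_pfaffianIdeal [CharP k 2] (f g : Fin s → k) :
    (fun p : SkewIndex s => wedge f g p.1.1 p.1.2) ∈
      MvPolynomial.zeroLocus k (pfaffianIdeal F s) := by
  rw [pfaffianIdeal, MvPolynomial.zeroLocus_span]
  rintro _ ⟨i, j, l, t, -, -, -, rfl⟩
  rw [map_add, map_add, map_mul, map_mul, map_mul]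
  simp only [aeval_genericSkew]
  simp only [wedge_apply]
  linear_combination (f i * f j * g l * g t + f i * f l * g j * g t + f i * f t * g j * g l +
    f j * f l * g i * g t + f j * f t * g i * g l + f l * f t * g i * g j) *
    CharTwo.two_eq_zero (R := k)

theorem wedge_mem_zeroLocus_linearIdeal [CharP k 2] {v : Fin s → Fin n → F} {f g h : Fin s → k}
    (hfg : (∑ i, f i • algebraMap F k ∘ v i) * (∑ i, g i • algebraMap F k ∘ v i) =
      (∑ i, h i • algebraMap F k ∘ v i) ^ 2) :
    (fun p : SkewIndex s => wedge f g p.1.1 p.1.2) ∈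
      MvPolynomial.zeroLocus k (linearIdeal (matCode v)) := by
  rw [linearIdeal, MvPolynomial.zeroLocus_span]
  rintro _ ⟨a, ha, rfl⟩
  obtain ⟨b, hb, hab⟩ := exists_eq_sum_of_forall_matCode ha
  -- The form `a` takes the same value at `f ∧ g` and at `h ∧ h = 0`: on wedges it only depends on
  -- the product of the two vectors.
  set V : Fin s → Fin n → k := fun i => algebraMap F k ∘ v i
  have hbV : ∀ i, ∑ t, algebraMap F k (b t) * (V i t * V i t) = 0 := fun i => by
    simpa [V] using congrArg (algebraMap F k) (hb i)
  have haV : ∀ p : SkewIndex s,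
      algebraMap F k (a p) = ∑ t, algebraMap F k (b t) * (V p.1.1 t * V p.1.2 t) := fun p => by
    simp [V, hab]
  calc MvPolynomial.aeval (fun p : SkewIndex s => wedge f g p.1.1 p.1.2)
        (∑ p : SkewIndex s, MvPolynomial.C (a p) * genericSkew F s p.1.1 p.1.2)
      = ∑ p : SkewIndex s, algebraMap F k (a p) * wedge f g p.1.1 p.1.2 := by
        simp only [map_sum, map_mul, MvPolynomial.aeval_C, aeval_genericSkew]
    _ = ∑ t, algebraMap F k (b t) * ((∑ i, f i • V i) * ∑ i, g i • V i) t := by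
        simp only [haV, sum_skewIndex_mul_wedge V _ hbV]
    _ = ∑ t, algebraMap F k (b t) * ((∑ i, h i • V i) * ∑ i, h i • V i) t := by
        rw [hfg, sq]
    _ = ∑ p : SkewIndex s, algebraMap F k (a p) * wedge h h p.1.1 p.1.2 := by
        simp only [haV, sum_skewIndex_mul_wedge V _ hbV]
    _ = 0 := by simp [wedge_apply, CharTwo.add_self_eq_zero]

theorem wedge_mem_zeroLocus_pfaffianIdealPlus [CharP k 2] {v : Fin s → Fin n → F}
    {f g h : Fin s → k}
    (hfg : (∑ i, f i • algebraMap F k ∘ v i) * (∑ i, g i • algebraMap F k ∘ v i) =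
      (∑ i, h i • algebraMap F k ∘ v i) ^ 2) :
    (fun p : SkewIndex s => wedge f g p.1.1 p.1.2) ∈
      MvPolynomial.zeroLocus k (pfaffianIdealPlus (matCode v)) := by
  refine Set.singleton_subset_iff.1 (MvPolynomial.le_zeroLocus_iff_le_vanishingIdeal.2 ?_)
  exact sup_le
    (MvPolynomial.le_zeroLocus_iff_le_vanishingIdeal.1
      (Set.singleton_subset_iff.2 (wedge_mem_zeroLocus_pfaffianIdeal f g)))
    (MvPolynomial.le_zeroLocus_iff_le_vanishingIdeal.1
      (Set.singleton_subset_iff.2 (wedge_mem_zeroLocus_linearIdeal hfg)))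

end Points

section Parametrization

theorem exists_mul_eq_one_of_linearIndependent_row {F ι κ : Type*} [Field F] [Finite ι]
    [DecidableEq ι] [Fintype κ] {A : Matrix ι κ F} (hA : LinearIndependent F A.row) :
    ∃ B : Matrix κ ι F, A * B = 1 := by
  classical
  have := Fintype.ofFinite ι
  obtain ⟨g, hg⟩ := A.vecMulLinear.exists_leftInverse_of_injective
    (LinearMap.ker_eq_bot.2 (Matrix.vecMul_injective_iff.2 hA))
  refine ⟨LinearMap.toMatrixRight' g, Matrix.toLinearMapRight'.injective ?_⟩
  rw [Matrix.toLinearMapRight'_mul, Matrix.toLinearMapRight'_one,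
    Matrix.toLinearMapRight', LinearEquiv.symm_apply_apply]
  exact hg

variable {F k : Type*} [Field F] [Field k] [Algebra F k] {s n d : ℕ}

theorem sum_vecMul_map_equivFun_smul {ι : Type*} [Fintype ι] {D : Submodule F (Fin n → F)}
    (v : Module.Basis (Fin s) F D) (w : ι → D) (e : ι → k) :
    ∑ i, Matrix.vecMul e ((Matrix.of fun a => v.equivFun (w a)).map (algebraMap F k)) i •
        algebraMap F k ∘ (v i : Fin n → F) =
      ∑ a, e a • algebraMap F k ∘ (w a : Fin n → F) := by
  have hw : ∀ a, algebraMap F k ∘ (w a : Fin n → F) =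
      ∑ i, algebraMap F k (v.equivFun (w a) i) • algebraMap F k ∘ (v i : Fin n → F) := by
    intro a
    ext t
    conv_lhs => rw [← v.sum_equivFun (w a)]
    simp only [Submodule.coe_sum, Submodule.coe_smul, Function.comp_apply, Finset.sum_apply,
      Pi.smul_apply, smul_eq_mul, map_sum, map_mul]
  simp only [hw, Finset.smul_sum, smul_smul]
  rw [Finset.sum_comm]
  simp only [← Finset.sum_smul]
  rfl

theorem eval_comp_vecMul_map_algebraMap {ι κ : Type*} [Fintype ι] (u : Fin d → k)
    (e : ι → MvPolynomial (Fin d) k) (T : Matrix ι κ k) :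
    MvPolynomial.eval u ∘ Matrix.vecMul e (T.map (algebraMap k (MvPolynomial (Fin d) k))) =
      Matrix.vecMul (MvPolynomial.eval u ∘ e) T := by
  ext i
  simp only [Function.comp_apply, Matrix.vecMul, dotProduct, Matrix.map_apply, map_sum, map_mul,
    MvPolynomial.algebraMap_eq, MvPolynomial.eval_C]

theorem natCast_le_affineDim_of_wedge [CharP k 2] [Infinite k] {ι : Type*} [Fintype ι]
    {D : Submodule F (Fin n → F)} (v : Module.Basis (Fin s) F D) {w : ι → D}
    (hw : LinearIndependent F w) (c c' : ι → MvPolynomial (Fin d) k)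
    (hsq : ∀ u, ∃ h : ι → k,
      (∑ a, MvPolynomial.eval u (c a) • algebraMap F k ∘ (w a : Fin n → F)) *
        (∑ a, MvPolynomial.eval u (c' a) • algebraMap F k ∘ (w a : Fin n → F)) =
      (∑ a, h a • algebraMap F k ∘ (w a : Fin n → F)) ^ 2)
    (hlead : ∀ j : Fin d, ∃ a b, restrictVars k j (wedge c c' a b) = 0 ∧
      restrictVars k (j + 1) (wedge c c' a b) ≠ 0) :
    (d : WithBot ℕ∞) ≤
      affineDim (MvPolynomial.zeroLocus k
        (pfaffianIdealPlus (matCode fun i => (v i : Fin n → F)))) := by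
  classical
  let T : Matrix ι (Fin s) F := Matrix.of fun a => v.equivFun (w a)
  have hT : LinearIndependent F T.row := hw.map' _ v.equivFun.ker
  obtain ⟨S, hTS⟩ := exists_mul_eq_one_of_linearIndependent_row hT
  let Tk := T.map (algebraMap F k)
  let Sk := S.map (algebraMap F k)
  let TX := Tk.map (algebraMap k (MvPolynomial (Fin d) k))
  have hTSX : TX * Sk.map (algebraMap k (MvPolynomial (Fin d) k)) = 1 := by
    rw [← Matrix.map_mul, ← Matrix.map_mul, hTS, Matrix.map_one _ (map_zero _) (map_one _),
      Matrix.map_one _ (map_zero _) (map_one _)]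
  refine natCast_le_affineDim_of_param
    (fun p : SkewIndex s => wedge (Matrix.vecMul c TX) (Matrix.vecMul c' TX) p.1.1 p.1.2)
    (fun u => ?_) fun j => ?_
  · obtain ⟨h, hh⟩ := hsq u
    have hpoint := wedge_mem_zeroLocus_pfaffianIdealPlus (v := fun i => (v i : Fin n → F))
      (f := Matrix.vecMul (MvPolynomial.eval u ∘ c) Tk)
      (g := Matrix.vecMul (MvPolynomial.eval u ∘ c') Tk) (h := Matrix.vecMul h Tk)
      (by simpa only [Tk, T, sum_vecMul_map_equivFun_smul, Function.comp_apply] using hh)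
    rw [← eval_comp_vecMul_map_algebraMap, ← eval_comp_vecMul_map_algebraMap, ← map_wedge] at hpoint
    exact hpoint
  · obtain ⟨a, b, hab⟩ := hlead j
    refine ⟨((Sk.map (algebraMap k (MvPolynomial (SkewIndex s) k))).transpose * genericSkew k s *
      Sk.map (algebraMap k (MvPolynomial (SkewIndex s) k))) a b, ?_⟩
    rwa [aeval_transpose_mul_genericSkew_mul, Matrix.vecMul_vecMul, Matrix.vecMul_vecMul, hTSX,
      Matrix.vecMul_one, Matrix.vecMul_one]

end Parametrization
section GeometricProgression

variable {F k : Type*} [Field F] [Field k] [Algebra F k] {s n d : ℕ}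

theorem sum_smul_comp_mul_pow_add (u : Fin d → k) (x y : Fin n → F) (m : ℕ) :
    ∑ i : Fin d, u i • algebraMap F k ∘ (y * x ^ (i + m : ℕ)) =
      (∑ i : Fin d, u i • algebraMap F k ∘ (y * x ^ (i : ℕ))) * (algebraMap F k ∘ x) ^ m := by
  ext t
  simp [Finset.sum_mul, pow_add, mul_assoc]

theorem natCast_le_affineDim_of_geometric [CharP k 2] [Infinite k]
    {D : Submodule F (Fin n → F)} (v : Module.Basis (Fin s) F D) {w : Fin (d + 2) → D}
    (hw : LinearIndependent F w) {x y : Fin n → F}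
    (hxy : ∀ a, (w a : Fin n → F) = y * x ^ (a : ℕ)) :
    (d : WithBot ℕ∞) ≤
      affineDim (MvPolynomial.zeroLocus k
        (pfaffianIdealPlus (matCode fun i => (v i : Fin n → F)))) := by
  -- The points are `f ∧ (x ^ 2 * f)` with `f = ∑ uᵢ y xⁱ`, and `f * (x ^ 2 * f) = (x * f) ^ 2`.
  let c : Fin (d + 2) → MvPolynomial (Fin d) k :=
    fun a => if h : (a : ℕ) < d then MvPolynomial.X ⟨a, h⟩ else 0
  let c' : Fin (d + 2) → MvPolynomial (Fin d) k := Fin.cons 0 (Fin.cons 0 MvPolynomial.X)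
  refine natCast_le_affineDim_of_wedge v hw c c' (fun u => ?_) fun j => ?_
  · let h : Fin (d + 2) → k := Fin.cons 0 fun a => if h : (a : ℕ) < d then u ⟨a, h⟩ else 0
    have hc : ∑ a, MvPolynomial.eval u (c a) • algebraMap F k ∘ (w a : Fin n → F) =
        ∑ i : Fin d, u i • algebraMap F k ∘ (y * x ^ (i : ℕ)) := by
      simp [Fin.sum_univ_castSucc, c, hxy]
    have hc' : ∑ a, MvPolynomial.eval u (c' a) • algebraMap F k ∘ (w a : Fin n → F) =
        ∑ i : Fin d, u i • algebraMap F k ∘ (y * x ^ (i + 2 : ℕ)) := by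
      simp [Fin.sum_univ_succ, c', hxy, add_assoc]
    have hh : ∑ a, h a • algebraMap F k ∘ (w a : Fin n → F) =
        ∑ i : Fin d, u i • algebraMap F k ∘ (y * x ^ (i + 1 : ℕ)) := by
      rw [Fin.sum_univ_succ, Fin.sum_univ_castSucc]
      simp [h, hxy]
    refine ⟨h, ?_⟩
    rw [hc, hc', hh, sum_smul_comp_mul_pow_add, sum_smul_comp_mul_pow_add]
    ring
  · have hc : ∀ (i : ℕ) (a : Fin (d + 2)), i ≤ a → restrictVars k i (c a) = 0 := by
      intro i a hi
      dsimp only [c]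
      split_ifs
      · rw [restrictVars_X, if_neg (by simpa using hi)]
      · exact map_zero _
    have hwedge : wedge c c' j.castSucc.castSucc j.succ.succ =
        MvPolynomial.X j ^ 2 + c' j.castSucc.castSucc * c j.succ.succ := by
      simp [wedge_apply, c, c', sq]
    refine ⟨j.castSucc.castSucc, j.succ.succ, ?_⟩
    simp only [hwedge, map_add, map_mul, map_pow, restrictVars_X,
      hc j j.succ.succ (by simp only [Fin.val_succ]; omega),
      hc (j + 1) j.succ.succ (by simp only [Fin.val_succ]; omega)]
    simp

end GeometricProgression

section Top

variable {F k : Type*} [Field F] [Field k] [Algebra F k] {s n : ℕ}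

theorem zero_le_affineDim [CharP k 2] [Infinite k] {D : Submodule F (Fin n → F)}
    (v : Module.Basis (Fin s) F D) :
    0 ≤ affineDim (MvPolynomial.zeroLocus k
      (pfaffianIdealPlus (matCode fun i => (v i : Fin n → F)))) := by
  simpa using natCast_le_affineDim_of_wedge (k := k) (d := 0) v
    (linearIndependent_empty_type (v := (Fin.elim0 : Fin 0 → D))) Fin.elim0 Fin.elim0
    (fun _ => ⟨Fin.elim0, by simp⟩) fun j => j.elim0

theorem exists_sum_single_sq_eq [IsAlgClosed k] {D : Submodule F (Fin n → F)} {w : Fin n → D}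
    (hw : ∀ a, (w a : Fin n → F) = Pi.single a 1) (e e' : Fin n → k) :
    ∃ h : Fin n → k,
      (∑ a, e a • algebraMap F k ∘ (w a : Fin n → F)) *
        (∑ a, e' a • algebraMap F k ∘ (w a : Fin n → F)) =
      (∑ a, h a • algebraMap F k ∘ (w a : Fin n → F)) ^ 2 := by
  have sum_eq : ∀ e : Fin n → k, ∑ a, e a • algebraMap F k ∘ (w a : Fin n → F) = e := by
    intro e
    ext t
    simp [hw, Pi.single_apply, apply_ite (algebraMap F k)]
  choose h hh using fun a => IsAlgClosed.exists_pow_nat_eq (e a * e' a) two_pos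
  exact ⟨h, by rw [sum_eq, sum_eq, sum_eq]; exact (funext hh).symm⟩

theorem natCast_two_mul_le_affineDim_add_three_of_eq_top [CharP k 2] [IsAlgClosed k]
    {D : Submodule F (Fin n → F)} (hD : D = ⊤) (v : Module.Basis (Fin s) F D) :
    ((2 * n : ℕ) : WithBot ℕ∞) ≤
      affineDim (MvPolynomial.zeroLocus k
        (pfaffianIdealPlus (matCode fun i => (v i : Fin n → F)))) + 3 := by
  have : Infinite k := IsAlgClosed.instInfinite
  obtain hn | hn := lt_or_ge n 2
  · calc ((2 * n : ℕ) : WithBot ℕ∞) ≤ 0 + 3 := by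
          rw [zero_add]; exact_mod_cast (by omega : 2 * n ≤ 3)
      _ ≤ _ := by gcongr; exact zero_le_affineDim v
  obtain ⟨N, rfl⟩ := Nat.exists_eq_add_of_le' hn
  let w : Fin (N + 2) → D := fun a => ⟨Pi.single a 1, hD ▸ Submodule.mem_top⟩
  have hw : LinearIndependent F w :=
    .of_comp D.subtype (Pi.linearIndependent_single_one (Fin (N + 2)) F)
  -- The rows `(t, 0, p)` and `(0, 1, q)` parametrize the part of the affine cone over the
  -- Grassmannian of planes where the first Plücker coordinate `t` is nonzero.
  let c : Fin (N + 2) → MvPolynomial (Fin (N + N + 1)) k :=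
    Fin.cons (MvPolynomial.X 0) (Fin.cons 0 fun j => MvPolynomial.X (j.castAdd N).succ)
  let c' : Fin (N + 2) → MvPolynomial (Fin (N + N + 1)) k :=
    Fin.cons 0 (Fin.cons 1 fun j => MvPolynomial.X (j.natAdd N).succ)
  have hdim := natCast_le_affineDim_of_wedge v hw c c'
    (fun u => exists_sum_single_sq_eq (fun _ => rfl) _ _) fun j => by
      induction j using Fin.cases with
      | zero =>
        refine ⟨0, 1, ?_⟩
        simp [wedge_apply, c, c', restrictVars_X]
      | succ j =>
        induction j using Fin.addCases with
        | left j =>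
          refine ⟨1, j.succ.succ, ?_⟩
          simp [wedge_apply, c, c', restrictVars_X]
        | right j =>
          refine ⟨0, j.succ.succ, ?_⟩
          simp [wedge_apply, c, c', restrictVars_X]
  calc ((2 * (N + 2) : ℕ) : WithBot ℕ∞) = ((N + N + 1 : ℕ) : WithBot ℕ∞) + 3 := by
        norm_cast; omega
    _ ≤ _ := by gcongr

end Top

section GRS

variable {L : Type*} [Field L] {n r : ℕ} {x y : Fin n → L}

theorem mem_grs_iff {g : Fin n → L} :
    g ∈ grs r x y ↔ ∃ P : L[X], P.degree < r ∧ ∀ i, y i * P.eval (x i) = g i := by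
  simp [grs, Polynomial.mem_degreeLT, Polynomial.leval_apply, funext_iff]

theorem mul_pow_mem_grs {a : ℕ} (ha : a < r) (x y : Fin n → L) : y * x ^ a ∈ grs r x y :=
  mem_grs_iff.2 ⟨Polynomial.X ^ a, by rw [Polynomial.degree_X_pow]; exact_mod_cast ha, by simp⟩

theorem linearIndependent_mul_pow (hx : Function.Injective x) (hy : ∀ i, y i ≠ 0) (hr : r ≤ n) :
    LinearIndependent L fun a : Fin r => y * x ^ (a : ℕ) := by
  rw [Fintype.linearIndependent_iff]
  intro c hc
  let P := (Polynomial.degreeLTEquiv L r).symm c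
  have hP : (P : L[X]) = 0 := by
    refine Polynomial.eq_zero_of_degree_lt_of_eval_index_eq_zero Finset.univ hx.injOn ?_
      fun i _ => ?_
    · refine (Polynomial.mem_degreeLT.1 P.2).trans_le ?_
      simpa using hr
    · refine (mul_eq_zero.1 ?_).resolve_left (hy i)
      rw [Polynomial.eval_eq_sum_degreeLTEquiv P.2]
      simpa [P, Finset.mul_sum, mul_left_comm] using congrFun hc i
  exact congrFun ((LinearEquiv.map_eq_zero_iff _).1 (Subtype.ext hP))

theorem grs_eq_top (hx : Function.Injective x) (hy : ∀ i, y i ≠ 0) (hn : n ≤ r) :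
    grs r x y = ⊤ := by
  refine eq_top_iff.2 fun g _ => mem_grs_iff.2
    ⟨Lagrange.interpolate Finset.univ x fun i => (y i)⁻¹ * g i, ?_, fun i => ?_⟩
  · refine (Lagrange.degree_interpolate_lt _ hx.injOn).trans_le ?_
    simpa using hn
  · rw [Lagrange.eval_interpolate_at_node _ hx.injOn (Finset.mem_univ i),
      mul_inv_cancel_left₀ (hy i)]

theorem natCast_le_affineDim_add_two_of_grs_le {k : Type*} [Field k] [Algebra L k] [CharP k 2]
    [Infinite k] {s : ℕ} (hx : Function.Injective x) (hy : ∀ i, y i ≠ 0) (hr : r ≤ n)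
    {D : Submodule L (Fin n → L)} (hD : grs r x y ≤ D) (v : Module.Basis (Fin s) L D) :
    (r : WithBot ℕ∞) ≤
      affineDim (MvPolynomial.zeroLocus k
        (pfaffianIdealPlus (matCode fun i => (v i : Fin n → L)))) + 2 := by
  obtain hr2 | hr2 := lt_or_ge r 2
  · calc (r : WithBot ℕ∞) ≤ 0 + 2 := by rw [zero_add]; exact_mod_cast hr2.le
      _ ≤ _ := by gcongr; exact zero_le_affineDim v
  obtain ⟨d, rfl⟩ := Nat.exists_eq_add_of_le' hr2
  have hli : LinearIndependent L
      fun a : Fin (d + 2) => (⟨y * x ^ (a : ℕ), hD (mul_pow_mem_grs a.2 x y)⟩ : D) :=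
    .of_comp D.subtype (linearIndependent_mul_pow hx hy hr)
  have hdim := natCast_le_affineDim_of_geometric (k := k) v hli fun _ => rfl
  push_cast
  gcongr

end GRS

section Extension

variable {K L : Type*} [Field K] [Field L] [Algebra K L] {n r : ℕ} {x y : Fin n → L}

theorem mem_extendCode_dualCode {C : Submodule K (Fin n → K)} {g : Fin n → L}
    (hg : ∀ c ∈ C, ∑ i, algebraMap K L (c i) * g i = 0) : g ∈ extendCode L (dualCode C) := by
  let U := Submodule.span K (Set.range g)
  have : FiniteDimensional K U := .span_of_finite K (Set.finite_range g)
  let b := Module.finBasis K U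
  let g' : Fin n → U := fun i => ⟨g i, Submodule.subset_span (Set.mem_range_self i)⟩
  have hgb : g = ∑ j, (b j : L) • fun i => algebraMap K L (b.repr (g' i) j) := by
    ext i
    have hgi : g i = ((∑ j, b.repr (g' i) j • b j : U) : L) := by rw [b.sum_repr]
    rw [hgi]
    simp only [Submodule.coe_sum, Submodule.coe_smul, Finset.sum_apply, Pi.smul_apply, smul_eq_mul]
    exact Finset.sum_congr rfl fun j _ => by rw [Algebra.smul_def, mul_comm]
  rw [hgb]
  refine sum_mem fun j _ => Submodule.smul_mem _ _ (Submodule.subset_span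
    ⟨fun i => b.repr (g' i) j, fun c hc => ?_, rfl⟩)
  have hg' : ∑ i, c i • g' i = 0 := by
    ext
    simpa [g', Algebra.smul_def] using hg c hc
  simpa using congrArg (b.repr · j) hg'

theorem mem_alternant_iff {c : Fin n → K} :
    c ∈ alternant K r x y ↔
      ∀ P : L[X], P.degree < r → ∑ i, algebraMap K L (c i) * (y i * P.eval (x i)) = 0 := by
  constructor
  · intro h P hP
    rw [← h _ (mem_grs_iff.2 ⟨P, hP, fun _ => rfl⟩)]
    exact Finset.sum_congr rfl fun i _ => mul_comm _ _
  · intro h g hg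
    obtain ⟨P, hP, hgP⟩ := mem_grs_iff.1 hg
    rw [← h P hP]
    refine Finset.sum_congr rfl fun i _ => ?_
    rw [hgP, mul_comm]
    rfl

theorem grs_le_extendCode_dualCode {C : Submodule K (Fin n → K)} (hC : C ≤ alternant K r x y) :
    grs r x y ≤ extendCode L (dualCode C) := by
  intro g hg
  obtain ⟨P, hP, hgP⟩ := mem_grs_iff.1 hg
  refine mem_extendCode_dualCode fun c hc => ?_
  simp only [← hgP]
  exact mem_alternant_iff.1 (hC hc) P hP

end Extension

section Goppa

theorem perfectRing_of_finiteDimensional (F : Type*) {A : Type*} [Field F] [CommRing A]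
    [Algebra F A] [FiniteDimensional F A] [IsReduced A] (p : ℕ) [Fact p.Prime] [CharP F p]
    [CharP A p] [PerfectRing F p] : PerfectRing A p := by
  -- The Frobenius is injective and semilinear over a bijection of `F`, so it maps bases to bases.
  let b := Module.finBasis F A
  have hli : LinearIndependent F (frobenius A p ∘ b) :=
    b.linearIndependent.map_of_surjective_injective (frobenius F p) (frobenius A p).toAddMonoidHom
      (surjective_frobenius F p) (fun t ht => frobenius_inj A p (ht.trans (map_zero _).symm))
      fun t m => by simp [Algebra.smul_def, frobenius_def, mul_pow]
  refine PerfectRing.ofSurjective A p fun t => ?_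
  have ht : t ∈ Submodule.span F (Set.range (frobenius A p ∘ b)) := by
    rw [hli.span_eq_top_of_card_eq_finrank' (Fintype.card_fin _)]
    exact Submodule.mem_top
  obtain ⟨c, rfl⟩ := (Submodule.mem_span_range_iff_exists_fun F).1 ht
  choose e he using fun i => surjective_frobenius F p (c i)
  refine ⟨∑ i, e i • b i, ?_⟩
  simp [← he, Algebra.smul_def, frobenius_def, mul_pow]

variable {L : Type*} [Field L] [PerfectField L] {G : L[X]}

theorem exists_dvd_sub_pow_char (p : ℕ) [Fact p.Prime] [CharP L p] (hG : Squarefree G)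
    (P : L[X]) : ∃ a : L[X], a.degree < G.degree ∧ G ∣ P - a ^ p := by
  by_cases hunit : IsUnit G
  · exact ⟨0, by simpa [bot_lt_iff_ne_bot] using hG.ne_zero, hunit.dvd⟩
  have : Nontrivial (AdjoinRoot G) :=
    AdjoinRoot.nontrivial G fun h => hunit (Polynomial.isUnit_iff_degree_eq_zero.2 h)
  have : CharP (AdjoinRoot G) p := charP_of_injective_algebraMap (algebraMap L _).injective p
  have : FiniteDimensional L (AdjoinRoot G) := (AdjoinRoot.powerBasis hG.ne_zero).finite
  have : IsReduced (AdjoinRoot G) :=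
    (Ideal.isRadical_iff_quotient_reduced _).1 (isRadical_iff_span_singleton.1 hG.isRadical)
  have := perfectRing_of_finiteDimensional L (A := AdjoinRoot G) p
  obtain ⟨t, ht⟩ := surjective_frobenius (AdjoinRoot G) p (AdjoinRoot.mk G P)
  obtain ⟨a, rfl⟩ := AdjoinRoot.mk_surjective t
  have hmod : AdjoinRoot.mk G (a % G) = AdjoinRoot.mk G a :=
    AdjoinRoot.mk_eq_mk.2 ⟨-(a / G), by linear_combination EuclideanDomain.div_add_mod a G⟩
  refine ⟨a % G, Polynomial.degree_mod_lt _ hG.ne_zero, AdjoinRoot.mk_eq_mk.1 ?_⟩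
  rw [map_pow, hmod, ← ht, frobenius_def]

theorem exists_eq_sq_add_mul [CharP L 2] (hG : Squarefree G) {P : L[X]}
    (hP : P.degree < (2 * G.natDegree : ℕ)) :
    ∃ a b : L[X], a.degree < G.natDegree ∧ b.degree < G.natDegree ∧
      P = a ^ 2 + G * b := by
  obtain ⟨a, ha, b, hb⟩ := exists_dvd_sub_pow_char 2 hG P
  rw [Polynomial.degree_eq_natDegree hG.ne_zero] at ha
  refine ⟨a, b, ha, ?_, by rw [← hb]; ring⟩
  have ha2 : (a ^ 2).degree < (2 * G.natDegree : ℕ) := by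
    rw [sq, Polynomial.degree_mul, two_mul, Nat.cast_add]
    exact lt_of_le_of_lt (by gcongr) (WithBot.add_lt_add_left (WithBot.natCast_ne_bot _) ha)
  have hdeg : (G.natDegree : WithBot ℕ) + b.degree < G.natDegree + G.natDegree := by
    rw [← Polynomial.degree_eq_natDegree hG.ne_zero, ← Polynomial.degree_mul, ← hb,
      Polynomial.degree_eq_natDegree hG.ne_zero, ← Nat.cast_add, ← two_mul]
    exact (Polynomial.degree_sub_le _ _).trans_lt (max_lt hP ha2)
  exact lt_of_add_lt_add_left hdeg

theorem goppa_le_alternant_sq {K : Type*} [Field K] [Algebra K L] (hK : Nat.card K = 2)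
    [CharP L 2] {n : ℕ} {x : Fin n → L} (hG : Squarefree G) (hGx : ∀ i, G.eval (x i) ≠ 0) :
    goppa K x G ≤ alternant K (2 * G.natDegree) x fun i => (G.eval (x i))⁻¹ ^ 2 := by
  have : Finite K := Nat.finite_of_card_ne_zero (by omega)
  have := Fintype.ofFinite K
  have sq_eq_self : ∀ t : K, t ^ 2 = t := fun t => by
    rw [← hK, Nat.card_eq_fintype_card, FiniteField.pow_card]
  intro c hc
  rw [goppa, mem_alternant_iff] at hc
  refine mem_alternant_iff.2 fun P hP => ?_
  obtain ⟨a, b, ha, hb, rfl⟩ := exists_eq_sq_add_mul hG hP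
  calc ∑ i, algebraMap K L (c i) * ((G.eval (x i))⁻¹ ^ 2 * (a ^ 2 + G * b).eval (x i))
      = ∑ i, ((algebraMap K L (c i) * ((G.eval (x i))⁻¹ * a.eval (x i))) ^ 2 +
          algebraMap K L (c i) * ((G.eval (x i))⁻¹ * b.eval (x i))) := by
        refine Finset.sum_congr rfl fun i _ => ?_
        rw [mul_pow, ← map_pow, sq_eq_self, Polynomial.eval_add, Polynomial.eval_pow,
          Polynomial.eval_mul]
        field_simp [hGx i]
    _ = (∑ i, algebraMap K L (c i) * ((G.eval (x i))⁻¹ * a.eval (x i))) ^ 2 +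
          ∑ i, algebraMap K L (c i) * ((G.eval (x i))⁻¹ * b.eval (x i)) := by
        rw [Finset.sum_add_distrib, sum_pow_char 2]
    _ = 0 := by rw [hc a ha, hc b hb, zero_pow two_ne_zero, add_zero]

end Goppa

end CodeRelations

theorem mainTheorem9_general {K L : Type*} [Field K] [Field L] [Algebra K L] {n : ℕ}
    {x : Fin n → L} (hx : Function.Injective x) :
    (CharP K 2 → ∀ (r : ℕ) (y : Fin n → L), (∀ i, y i ≠ 0) → r ≤ n →
      ∀ (s : ℕ) (v : Module.Basis (Fin s) L (extendCode L (dualCode (alternant K r x y)))),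
        (r : WithBot ℕ∞) ≤
          affineDim (variety (pfaffianIdealPlus (matCode fun i => (v i : Fin n → L)))) + 2) ∧
    (Nat.card K = 2 → PerfectField L → ∀ (r : ℕ) (Γ : L[X]), Γ.natDegree = r →
      Squarefree Γ → (∀ i, Γ.eval (x i) ≠ 0) → r ≤ n →
      ∀ (s : ℕ) (v : Module.Basis (Fin s) L (extendCode L (dualCode (goppa K x Γ)))),
        ((2 * r : ℕ) : WithBot ℕ∞) ≤
          affineDim (variety (pfaffianIdealPlus (matCode fun i => (v i : Fin n → L)))) + 3) := by
  have : Infinite (AlgebraicClosure L) := IsAlgClosed.instInfinite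
  have charTwo : CharP K 2 → CharP L 2 ∧ CharP (AlgebraicClosure L) 2 := fun _ =>
    ⟨charP_of_injective_algebraMap (algebraMap K L).injective 2,
      charP_of_injective_algebraMap (algebraMap K (AlgebraicClosure L)).injective 2⟩
  constructor
  · intro hK r y hy hr s v
    obtain ⟨-, _⟩ := charTwo hK
    exact natCast_le_affineDim_add_two_of_grs_le hx hy hr (grs_le_extendCode_dualCode le_rfl) v
  · rintro hK _ r Γ rfl hΓ hΓx hr s v
    have : Finite K := Nat.finite_of_card_ne_zero (by omega)
    have := Fintype.ofFinite K
    obtain ⟨_, _⟩ := charTwo (charP_of_card_eq_prime (by rw [← Nat.card_eq_fintype_card, hK]))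
    have hy : ∀ i, (Γ.eval (x i))⁻¹ ^ 2 ≠ 0 := fun i => pow_ne_zero 2 (inv_ne_zero (hΓx i))
    have hgrs := grs_le_extendCode_dualCode (goppa_le_alternant_sq hK hΓ hΓx)
    obtain hn | hn := le_total (2 * Γ.natDegree) n
    · exact (natCast_le_affineDim_add_two_of_grs_le hx hy hn hgrs v).trans
        (add_le_add_right (by norm_num : (2 : WithBot ℕ∞) ≤ 3) _)
    · refine le_trans ?_ (natCast_two_mul_le_affineDim_add_three_of_eq_top
        (top_le_iff.1 ((grs_eq_top hx hy hn).symm.trans_le hgrs)) v)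
      gcongr

theorem mainTheorem9 {K L : Type*} [Field K] [Finite K] [Field L] [Algebra K L]
    [FiniteDimensional K L] (m : ℕ) (hm : Module.finrank K L = m)
    (n : ℕ) (x : Fin n → L) (hx : Function.Injective x) :
    -- alternant codes over a finite field of characteristic 2
    (CharP K 2 → ∀ (r : ℕ) (y : Fin n → L), (∀ i, y i ≠ 0) →
      Module.finrank K (alternant K r x y) + r * m = n →
      ∀ (s : ℕ) (v : Module.Basis (Fin s) L (extendCode L (dualCode (alternant K r x y)))),
        (r : WithBot ℕ∞) ≤
          affineDim (variety (pfaffianIdealPlus (matCode fun i => (v i : Fin n → L)))) + 2) ∧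
    -- binary Goppa codes with a square-free Goppa polynomial
    (Nat.card K = 2 → ∀ (r : ℕ) (Γ : Polynomial L), Γ.natDegree = r → Squarefree Γ →
      (∀ i, Γ.eval (x i) ≠ 0) →
      Module.finrank K (goppa K x Γ) + r * m = n →
      ∀ (s : ℕ) (v : Module.Basis (Fin s) L (extendCode L (dualCode (goppa K x Γ)))),
        ((2 * r : ℕ) : WithBot ℕ∞) ≤
          affineDim (variety (pfaffianIdealPlus (matCode fun i => (v i : Fin n → L)))) + 3) := by
  have : Finite L := Module.finite_of_finite K
  have le_length : ∀ {a r : ℕ}, a + r * m = n → r ≤ n := fun {a r} h =>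
    (Nat.le_mul_of_pos_right r (hm ▸ Module.finrank_pos)).trans (by omega)
  obtain ⟨halt, hgoppa⟩ := mainTheorem9_general (K := K) hx
  exact ⟨fun hK r y hy hr => halt hK r y hy (le_length hr),
    fun hK r Γ hrΓ hΓ hΓx hr => hgoppa hK inferInstance r Γ hrΓ hΓ hΓx (le_length hr)⟩
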